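/- Permutations are finite words of distinct positive integers. West's stack-sorting map $s$ sends the empty word to itself, and $s(LmR)=s(L)\,s(R)\,m$ where $m$ is the largest entry of $LmR$. A permutation $\pi$ is uniquely sorted if it has exactly one preimage under $s$, i.e. $|s^{-1}(\pi)|=1$. Let $\mathcal U_{n}(312)$ be the set of uniquely sorted permutations of $\{1,\dots,n\}$ that avoid the pattern $312$. For $\pi=\pi_1\cdots\pi_n$, a permutation of $\{1,\dots,n\}$, let $\mathrm{Des}(\pi)=\{i\in\{1,\dots,n-1\}:\pi_i>\pi_{i+1}\}$, and let $\mathrm{rot}(\pi)$ be the reverse of $\pi^{-1}$, i.e. $\mathrm{rot}(\pi)_i=\pi^{-1}_{n+1-i}$. Let $\mathbf D_k$ be the set of Dyck paths of semilength $k$, written as words over $\{U,D\}$, and order it by $\Lambda\le_S\Lambda'$ if and only if for every $i\in\{1,\dots,2k\}$ the number of letters $U$ in $\Lambda_1\cdots\Lambda_i$ is at most the number of letters $U$ in $\Lambda'_1\cdots\Lambda'_i$ (the Stanley lattice $\mathcal L_k^S$). Let $\mathrm{Int}(\mathcal L_k^S)$ be the set of pairs $(\Lambda,\Lambda')$ in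 $\mathbf D_k\times\mathbf D_k$ with $\Lambda\le_S\Lambda'$. For $\pi\in\mathcal U_{2k+1}(312)$ put $\mathrm{DL}_k(\pi)=(\Lambda,\Lambda')$, where $\Lambda=\Lambda_1\cdots\Lambda_{2k}$ and $\Lambda'=\Lambda'_1\cdots\Lambda'_{2k}$ are given by $\Lambda_i=D$ if $2k+1-i\in\mathrm{Des}(\pi)$ and $\Lambda_i=U$ otherwise, and $\Lambda'_i=U$ if $i\in\mathrm{Des}(\mathrm{rot}(\pi))$ and $\Lambda'_i=D$ otherwise. Theorem. For each nonnegative integer $k$, one has $\mathrm{DL}_k(\pi)\in\mathrm{Int}(\mathcal L_k^S)$ for every $\pi\in\mathcal U_{2k+1}(312)$, and the map $\mathrm{DL}_k:\mathcal U_{2k+1}(312)\to\mathrm{Int}(\mathcal L_k^S)$ is a bijection. -/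

import Mathlib

namespace UniquelySorted

/-! ### Permutations, descents, patterns -/

/-- The one-line notation `π₁ π₂ ⋯ πₙ` of a permutation of `{1, …, n}`, as a word of positive
integers (`Fin n` is `{0, …, n-1}`, so positions and values are shifted by one). -/
def oneLine {n : ℕ} (π : Equiv.Perm (Fin n)) : List ℕ :=
  List.ofFn fun i => (π i : ℕ) + 1

/-- The descent set of a permutation of length `n + 1`. The element `i : Fin n` stands for the
descent `i + 1 ∈ {1, …, n}` in one-based indexing: it says `π_{i+1} > π_{i+2}`. -/
def descents {n : ℕ} (π : Equiv.Perm (Fin (n + 1))) : Finset (Fin n) :=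
  {i | π i.succ < π i.castSucc}

/-- The counterclockwise rotation by 90 degrees of (the plot of) a permutation, that is, the
reverse of the inverse permutation: `rot(π)_i = π⁻¹_{n+1-i}`. -/
def rot {n : ℕ} (π : Equiv.Perm (Fin n)) : Equiv.Perm (Fin n) :=
  Fin.revPerm.trans π.symm

/-- `π` contains the pattern `τ` (a word without repeated letters): some subsequence of the
entries of `π` has the same relative order as `τ`. -/
def ContainsPattern {n m : ℕ} (π : Equiv.Perm (Fin n)) (τ : Fin m → ℕ) : Prop :=
  ∃ f : Fin m → Fin n, StrictMono f ∧ ∀ a b, π (f a) < π (f b) ↔ τ a < τ b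

/-! ### The stack-sorting map -/

/-- West's stack-sorting map `s` on words: `s` fixes the empty word, and `s(L m R) = s(L) s(R) m`
where `m` is the largest letter. -/
def stackSort : List ℕ → List ℕ
  | [] => []
  | a :: l =>
    let w := a :: l
    let m := w.foldr max 0
    stackSort (w.take (w.idxOf m)) ++ stackSort (w.drop (w.idxOf m + 1)) ++ [m]
  termination_by w => w.length
  decreasing_by
    · have hm : ∀ v : List ℕ, v ≠ [] → v.foldr max 0 ∈ v := by
        intro v
        induction v with
        | nil => simp
        | cons b t ih =>
          intro _
          rcases eq_or_ne t [] with rfl | ht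
          · simp
          · rcases max_choice b (t.foldr max 0) with h | h
            · simp [h]
            · simp only [List.foldr_cons, h]
              exact List.mem_cons_of_mem _ (ih ht)
      have h := List.idxOf_lt_length_of_mem (hm (a :: l) (by simp))
      simp only [List.length_take]
      exact lt_of_le_of_lt (min_le_left _ _) h
    · simp only [List.length_drop, List.length_cons]
      omega

/-- The fertility of a permutation `w` (a word of distinct positive integers): the number of
permutations `v` (again words of distinct positive integers) with `s(v) = w`. -/
noncomputable def fertility (w : List ℕ) : ℕ :=
  {v : List ℕ | v.Nodup ∧ (∀ x ∈ v, 0 < x) ∧ stackSort v = w}.ncard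

/-- A permutation is uniquely sorted if its fertility is `1`. -/
def IsUniquelySorted {n : ℕ} (π : Equiv.Perm (Fin n)) : Prop :=
  fertility (oneLine π) = 1

/-- The set of uniquely sorted permutations of `{1, …, n}` that avoid the pattern `312`. -/
def uniquelySorted312 (n : ℕ) : Set (Equiv.Perm (Fin n)) :=
  {π | IsUniquelySorted π ∧ ¬ ContainsPattern π ![3, 1, 2]}

/-! ### Dyck paths and the Stanley lattice -/

/-- The set of Dyck paths of semilength `k`. -/
@[ext]
structure DyckPath (k : ℕ) where
  /-- the underlying Dyck word -/
  path : DyckWord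
  /-- it consists of `k` up steps and `k` down steps -/
  semilength_eq : path.semilength = k

/-- The word over `{U, D}` of a Dyck path. -/
def DyckPath.word {k : ℕ} (p : DyckPath k) : List DyckStep := p.path.toList

/-- The number of up steps among the first `i` letters of a word. -/
def upCount (w : List DyckStep) (i : ℕ) : ℕ := (w.take i).count DyckStep.U

theorem eq_of_upCount_eq (w v : List DyckStep) (hl : w.length = v.length)
    (h : ∀ i, upCount w i = upCount v i) : w = v := by
  induction w generalizing v with
  | nil => exact (List.length_eq_zero_iff.mp hl.symm).symm
  | cons a w ih =>
    cases v with
    | nil => simp at hl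
    | cons b v =>
      have hab : a = b := by
        have h1 := h 1
        revert h1
        cases a <;> cases b <;> simp [upCount]
      subst hab
      have hwv : w = v := by
        refine ih v (by simpa using hl) fun i => ?_
        have hi := h (i + 1)
        simpa [upCount, List.count_cons] using hi
      rw [hwv]

theorem DyckPath.length_word {k : ℕ} (p : DyckPath k) : p.word.length = 2 * k := by
  have h := p.path.two_mul_semilength_eq_length
  rw [p.semilength_eq] at h
  exact h.symm

/-- The Stanley lattice: `Λ ≤ Λ'` if `Λ` lies weakly below `Λ'`, i.e. every prefix of `Λ` has at
most as many up steps as the prefix of `Λ'` of the same length. -/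
instance (k : ℕ) : PartialOrder (DyckPath k) where
  le p q := ∀ i, upCount p.word i ≤ upCount q.word i
  le_refl _ _ := le_rfl
  le_trans _ _ _ h h' i := (h i).trans (h' i)
  le_antisymm p q h h' := DyckPath.ext <| DyckWord.ext <|
    eq_of_upCount_eq p.word q.word (p.length_word.trans q.length_word.symm)
      fun i => le_antisymm (h i) (h' i)

/-! ### The map `DL_k` -/

/-- The word `Λ = Λ₁ ⋯ Λ_{2k}` with `Λ_i = D` if `2k + 1 - i` is a descent of `π`, and `Λ_i = U`
otherwise. -/
def lowerWord {k : ℕ} (π : Equiv.Perm (Fin (2 * k + 1))) : List DyckStep :=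
  List.ofFn fun i : Fin (2 * k) => if i.rev ∈ descents π then DyckStep.D else DyckStep.U

/-- The word `Λ' = Λ'₁ ⋯ Λ'_{2k}` with `Λ'_i = U` if `i` is a descent of `rot(π)`, and `Λ'_i = D`
otherwise. -/
def upperWord {k : ℕ} (π : Equiv.Perm (Fin (2 * k + 1))) : List DyckStep :=
  List.ofFn fun i : Fin (2 * k) => if i ∈ descents (rot π) then DyckStep.U else DyckStep.D

/-- The pair of words `DL_k(π) = (Λ, Λ')`. -/
def DL (k : ℕ) (π : Equiv.Perm (Fin (2 * k + 1))) : List DyckStep × List DyckStep :=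
  (lowerWord π, upperWord π)

/-- An interval `(Λ, Λ')` of the Stanley lattice, seen as a pair of words over `{U, D}`. -/
def intervalWords {k : ℕ} (I : NonemptyInterval (DyckPath k)) :
    List DyckStep × List DyckStep :=
  (I.fst.word, I.snd.word)

end UniquelySorted

namespace UniquelySorted

/-! ### The stack-sorting map on words -/

/-! The argument has two halves. First, unique sortedness of a 312-avoiding word becomes a condition
on its ascent set. In a nonempty image of `s`, the recursion `s(L) s(R) m` gains at most one new
descent for each new letter `m`, so an image of length `n` has at most `(n - 1) / 2` descents.
Equality makes the word a ballot word and forces the cut between `s(L)` and `s(R)`, so the preimage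
is unique (`stackSort_injective_of_tight`). Conversely, a unique preimage forces the ballot
condition, since a cut without a descent yields a second preimage (`isBallot_of_unique`). For
312-avoiding words the ballot condition also suffices for a preimage to exist
(`exists_stackSort_eq`).

Second, a 312-avoiding permutation is encoded by its running maximum. The running maximum jumps
exactly at the ascents, and its values below the top one are exactly the inverse ascents. Hence
there is a bijection from ascents to inverse ascents that never moves a position down, so the
inverse ascents dominate the ascents. The two sets determine the running maximum, which determines
the permutation (`eq_of_ascents_eq`). Every dominating pair of equal size arises
(`exists_perm_ascents_eq`).

Read from right to left, the two sets are the up steps of `Λ` and `Λ'`: domination is the Stanley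
order and the ballot condition says that `Λ` is a Dyck path. The path `Λ'` is then Dyck too, because
it lies above `Λ` and has equally many up steps. -/

theorem foldr_max_append_cons (L R : List ℕ) (m : ℕ) (hL : ∀ x ∈ L, x < m)
    (hR : ∀ x ∈ R, x ≤ m) : (L ++ m :: R).foldr max 0 = m := by
  have hR' : R.foldr max 0 ≤ m := by
    clear hL
    induction R with
    | nil => simp
    | cons b t ih =>
      simp only [List.foldr_cons]
      exact max_le (hR b (by simp)) (ih fun x hx => hR x (by simp [hx]))
  induction L with
  | nil => simpa using hR'
  | cons b t ih =>
    rw [List.cons_append, List.foldr_cons, ih fun x hx => hL x (by simp [hx])]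
    exact max_eq_right (hL b (by simp)).le

theorem stackSort_nil : stackSort [] = [] := by rw [stackSort]

theorem stackSort_append_max (L R : List ℕ) (m : ℕ) (hL : ∀ x ∈ L, x < m)
    (hR : ∀ x ∈ R, x ≤ m) :
    stackSort (L ++ m :: R) = stackSort L ++ stackSort R ++ [m] := by
  have key : ∀ w : List ℕ, w ≠ [] → stackSort w =
      stackSort (w.take (w.idxOf (w.foldr max 0))) ++
        stackSort (w.drop (w.idxOf (w.foldr max 0) + 1)) ++ [w.foldr max 0] := by
    intro w hw
    cases w with
    | nil => exact absurd rfl hw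
    | cons a l => rw [stackSort]
  have hm : m ∉ L := fun h => lt_irrefl _ (hL m h)
  have hi : (L ++ m :: R).idxOf m = L.length := by
    rw [List.idxOf_append_of_notMem hm]; simp
  rw [key _ (by simp), foldr_max_append_cons L R m hL hR, hi]
  simp

/-- Induction along the decomposition `L m R` of a word at the first occurrence of its largest
letter `m`. -/
theorem max_induction {P : List ℕ → Prop} (nil : P [])
    (node : ∀ L m R, (∀ x ∈ L, x < m) → (∀ x ∈ R, x ≤ m) → P L → P R → P (L ++ m :: R))
    (v : List ℕ) : P v := by
  induction hn : v.length using Nat.strong_induction_on generalizing v with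
  | _ n ih =>
    rcases eq_or_ne v [] with rfl | hv
    · exact nil
    · obtain ⟨m, hm, hmax⟩ := Finset.exists_max_image v.toFinset id
        (by simpa [List.toFinset_nonempty_iff] using hv)
      obtain ⟨L, R, rfl, hL⟩ := List.eq_append_cons_of_mem (List.mem_toFinset.mp hm)
      simp only [List.length_append, List.length_cons] at hn
      refine node L m R (fun x hx => ?_) (fun x hx => ?_) (ih _ (by omega) L rfl)
        (ih _ (by omega) R rfl)
      · exact lt_of_le_of_ne (hmax x (by simp [hx])) fun h => hL (h ▸ hx)
      · exact hmax x (by simp [hx])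

theorem stackSort_perm (v : List ℕ) : (stackSort v).Perm v := by
  induction v using max_induction with
  | nil => rw [stackSort_nil]
  | node L m R hL hR ihL ihR =>
    rw [stackSort_append_max L R m hL hR, List.append_assoc]
    exact ihL.append ((List.perm_append_singleton m _).trans (ihR.cons m))

theorem mem_stackSort {v : List ℕ} {x : ℕ} : x ∈ stackSort v ↔ x ∈ v :=
  (stackSort_perm v).mem_iff

theorem stackSort_eq_nil {v : List ℕ} : stackSort v = [] ↔ v = [] := by
  rw [← List.length_eq_zero_iff, (stackSort_perm v).length_eq, List.length_eq_zero_iff]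

theorem mem_of_stackSort_eq {v v' : List ℕ} (h : stackSort v = stackSort v') {x : ℕ} :
    x ∈ v ↔ x ∈ v' := by
  rw [← mem_stackSort, h, mem_stackSort]

theorem stackSort_eq_append_max {v : List ℕ} (hv : v ≠ []) :
    ∃ A a, stackSort v = A ++ [a] ∧ ∀ x ∈ v, x ≤ a := by
  induction v using max_induction with
  | nil => exact absurd rfl hv
  | node L m R hL hR _ _ =>
    refine ⟨_, m, stackSort_append_max L R m hL hR, fun x hx => ?_⟩
    rcases List.mem_append.mp hx with h | h
    · exact (hL x h).le
    · rcases List.mem_cons.mp h with h | h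
      · exact h.le
      · exact hR x h

theorem exists_max_split {v : List ℕ} (hv : v ≠ []) :
    ∃ L m R, v = L ++ m :: R ∧ (∀ x ∈ L, x < m) ∧ ∀ x ∈ R, x ≤ m := by
  induction v using max_induction with
  | nil => exact absurd rfl hv
  | node L m R hL hR _ _ => exact ⟨L, m, R, rfl, hL, hR⟩

theorem fertility_eq_one_iff {w : List ℕ} (hw : w.Nodup) (hpos : ∀ x ∈ w, 0 < x) :
    fertility w = 1 ↔ ∃ v, stackSort v = w ∧ ∀ v', stackSort v' = w → v' = v := by
  have hset : {v : List ℕ | v.Nodup ∧ (∀ x ∈ v, 0 < x) ∧ stackSort v = w} =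
      {v | stackSort v = w} := by
    ext v
    refine ⟨fun h => h.2.2, ?_⟩
    rintro rfl
    exact ⟨(stackSort_perm v).nodup_iff.mp hw, fun x hx => hpos x (mem_stackSort.mpr hx), rfl⟩
  rw [fertility, hset, Set.ncard_eq_one]
  refine exists_congr fun v => ⟨fun h => ?_, fun h => ?_⟩
  · exact ⟨h.symm.subset rfl, fun v' hv' => h.subset hv'⟩
  · ext v'
    exact ⟨h.2 v', fun hv' => by rw [Set.mem_singleton_iff.mp hv']; exact h.1⟩

/-! ### Descents of words -/

/-- The number of descents of a word. -/
def descentCount : List ℕ → ℕ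
  | [] => 0
  | [_] => 0
  | a :: b :: l => (if b < a then 1 else 0) + descentCount (b :: l)

theorem descentCount_append (A B : List ℕ) (a b : ℕ) :
    descentCount (A ++ [a] ++ b :: B) =
      descentCount (A ++ [a]) + (if b < a then 1 else 0) + descentCount (b :: B) := by
  induction A with
  | nil => simp [descentCount]
  | cons x A ih =>
    cases A with
    | nil => simp [descentCount]; ring
    | cons y A =>
      simp only [List.cons_append, descentCount] at ih ⊢
      rw [ih]; ring

theorem descentCount_append_of_lt (A B : List ℕ) {a b : ℕ} (h : b < a) :
    descentCount (A ++ [a] ++ b :: B) =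
      descentCount (A ++ [a]) + 1 + descentCount (b :: B) := by
  rw [descentCount_append, if_pos h]

theorem descentCount_append_le (A B : List ℕ) :
    descentCount (A ++ B) ≤ descentCount A + descentCount B + 1 := by
  rcases List.eq_nil_or_concat A with rfl | ⟨A, a, rfl⟩
  · simp [descentCount]
  · cases B with
    | nil => simp [descentCount]
    | cons b B =>
      rw [List.concat_eq_append, descentCount_append]
      split_ifs <;> omega

theorem descentCount_concat_max {A : List ℕ} {m : ℕ} (h : ∀ x ∈ A, x ≤ m) :
    descentCount (A ++ [m]) = descentCount A := by
  rcases List.eq_nil_or_concat A with rfl | ⟨A, a, rfl⟩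
  · simp [descentCount]
  · rw [List.concat_eq_append] at h ⊢
    rw [descentCount_append, if_neg (not_lt.mpr (h a (by simp)))]
    simp [descentCount]

theorem descentCount_stackSort_append_max (L R : List ℕ) (m : ℕ) (hL : ∀ x ∈ L, x < m)
    (hR : ∀ x ∈ R, x ≤ m) :
    descentCount (stackSort (L ++ m :: R)) = descentCount (stackSort L ++ stackSort R) := by
  rw [stackSort_append_max L R m hL hR, descentCount_concat_max]
  intro x hx
  rcases List.mem_append.mp hx with h | h
  · exact (hL x (mem_stackSort.mp h)).le
  · exact hR x (mem_stackSort.mp h)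

/-- When `L` and `R` are both nonempty, the junction adds at most one descent while each part has
slack at least one; the final letter `m` adds none. -/
theorem descentCount_stackSort_le {v : List ℕ} (hv : v ≠ []) :
    2 * descentCount (stackSort v) + 1 ≤ (stackSort v).length := by
  induction v using max_induction with
  | nil => exact absurd rfl hv
  | node L m R hL hR ihL ihR =>
    rw [descentCount_stackSort_append_max L R m hL hR, stackSort_append_max L R m hL hR]
    have h := descentCount_append_le (stackSort L) (stackSort R)
    rcases eq_or_ne L [] with rfl | hL0
    · rcases eq_or_ne R [] with rfl | hR0
      · simp [stackSort_nil, descentCount]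
      · have := ihR hR0
        simp [stackSort_nil] at *; omega
    · rcases eq_or_ne R [] with rfl | hR0
      · have := ihL hL0
        simp [stackSort_nil] at *; omega
      · have := ihL hL0
        have := ihR hR0
        simp only [List.length_append, List.length_singleton]; omega

/-- A word of length `2d + 1` with `d` descents, such that the marks `+1` for the first letter and
for every letter following a descent, and `-1` for every letter following an ascent, have positive
partial sums. -/
def IsBallot (w : List ℕ) : Prop :=
  w.length = 2 * descentCount w + 1 ∧
    ∀ P, P ≠ [] → P <+: w → P.length ≤ 2 * descentCount P + 1

theorem isBallot_singleton (a : ℕ) : IsBallot [a] := by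
  refine ⟨by simp [descentCount], fun P hP h => ?_⟩
  have := h.length_le
  simp at this; omega

/-- The marks of the first word sum to `1`, and `b` is marked `+1` both as a first letter and after
a descent. So the partial sums over the second word are raised by one, ending at `2`, and the mark
`-1` of `m` brings the total back to `1`. -/
theorem IsBallot.append_max {A B : List ℕ} {a b m : ℕ} (hA : IsBallot (A ++ [a]))
    (hB : IsBallot (b :: B)) (hab : b < a) (hm : ∀ x ∈ A ++ [a] ++ b :: B, x ≤ m) :
    IsBallot (A ++ [a] ++ b :: B ++ [m]) := by
  have hlen : (A ++ [a] ++ b :: B ++ [m]).length =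
      2 * descentCount (A ++ [a] ++ b :: B ++ [m]) + 1 := by
    rw [descentCount_concat_max hm, descentCount_append_of_lt _ _ hab, List.length_append,
      List.length_append, hA.1, hB.1]
    simp; omega
  refine ⟨hlen, fun P hP h => ?_⟩
  rcases List.prefix_concat_iff.mp h with rfl | h
  · exact hlen.le
  · rcases List.prefix_or_prefix_of_prefix h (List.prefix_append _ _) with h' | ⟨Q, rfl⟩
    · exact hA.2 P hP h'
    · have hQ := (List.prefix_append_right_inj _).mp h
      cases Q with
      | nil => simpa using hA.1.le
      | cons c Q =>
        obtain ⟨rfl, _⟩ := List.cons_prefix_cons.mp hQ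
        have h1 := hB.2 _ (by simp) hQ
        rw [descentCount_append_of_lt _ _ hab, List.length_append, hA.1]
        omega

/-! ### Uniquely sorted words -/

/-- View `s` as the postorder reading of a decreasing binary tree. The first letter of `s(R)` is a
leaf, and `L` can be hung below it as a left subtree when all its letters are smaller. This supplies
second preimages in `isBallot_of_unique`. -/
theorem exists_stackSort_eq_append {R : List ℕ} (hR : R ≠ []) (L : List ℕ)
    (h : ∀ u ∈ (stackSort R).head?, ∀ x ∈ L, x < u) :
    ∃ R', stackSort R' = stackSort L ++ stackSort R := by
  induction R using max_induction with
  | nil => exact absurd rfl hR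
  | node P m Q hP hQ ihP ihQ =>
    rw [stackSort_append_max P Q m hP hQ] at h ⊢
    rcases eq_or_ne P [] with rfl | hP0
    · rcases eq_or_ne Q [] with rfl | hQ0
      · simp only [stackSort_nil, List.append_nil, List.nil_append, List.head?_cons,
          Option.mem_def, Option.some.injEq, forall_eq'] at h ⊢
        exact ⟨L ++ m :: [], by rw [stackSort_append_max L [] m h (by simp)]; simp [stackSort_nil]⟩
      · obtain ⟨c, C, hc⟩ := List.exists_cons_of_ne_nil (mt stackSort_eq_nil.mp hQ0)
        have h' : ∀ x ∈ L, x < c := by simpa [stackSort_nil, hc] using h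
        obtain ⟨Q', hQ'⟩ := ihQ hQ0 (by simpa [hc] using h')
        refine ⟨[] ++ m :: Q', ?_⟩
        have hcQ : c ∈ Q := mem_stackSort.mp (by simp [hc])
        rw [stackSort_append_max [] Q' m (by simp), hQ']
        · simp [stackSort_nil]
        · intro x hx
          rw [← mem_stackSort, hQ', List.mem_append, mem_stackSort, mem_stackSort] at hx
          rcases hx with hx | hx
          · exact (h' x hx).le.trans (hQ c hcQ)
          · exact hQ x hx
    · obtain ⟨c, C, hc⟩ := List.exists_cons_of_ne_nil (mt stackSort_eq_nil.mp hP0)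
      have h' : ∀ x ∈ L, x < c := by simpa [hc] using h
      obtain ⟨P', hP'⟩ := ihP hP0 (by simpa [hc] using h')
      refine ⟨P' ++ m :: Q, ?_⟩
      have hcP : c ∈ P := mem_stackSort.mp (by simp [hc])
      rw [stackSort_append_max P' Q m _ hQ, hP']
      · simp
      · intro x hx
        rw [← mem_stackSort, hP', List.mem_append, mem_stackSort, mem_stackSort] at hx
        rcases hx with hx | hx
        · exact (h' x hx).trans (hP c hcP)
        · exact hP x hx

theorem isBallot_of_unique {v : List ℕ} (hv : v ≠ []) (hnd : v.Nodup)
    (h : ∀ v', stackSort v' = stackSort v → v' = v) : IsBallot (stackSort v) := by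
  induction v using max_induction with
  | nil => exact absurd rfl hv
  | node L m R hL hR ihL ihR =>
    rw [List.nodup_append] at hnd
    obtain ⟨hndL, hndR, hdisj⟩ := hnd
    have hR' : ∀ x ∈ R, x < m := fun x hx => lt_of_le_of_ne (hR x hx) fun e =>
      (List.nodup_cons.mp hndR).1 (e ▸ hx)
    have hs := stackSort_append_max L R m hL hR
    rw [hs] at h ⊢
    rcases eq_or_ne L [] with rfl | hL0
    · rcases eq_or_ne R [] with rfl | hR0
      · simpa [stackSort_nil] using isBallot_singleton m
      -- The words `m R` and `R m` have the same image.
      · have := h (R ++ m :: []) (by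
          rw [stackSort_append_max R [] m hR' (by simp)]; simp [stackSort_nil])
        obtain ⟨c, C, rfl⟩ := List.exists_cons_of_ne_nil hR0
        simp only [List.cons_append, List.nil_append, List.cons.injEq] at this
        exact absurd this.1 (hR' c (by simp)).ne
    · rcases eq_or_ne R [] with rfl | hR0
      · have := h ([] ++ m :: L) (by
          rw [stackSort_append_max [] L m (by simp) fun x hx => (hL x hx).le]
          simp [stackSort_nil])
        obtain ⟨c, C, rfl⟩ := List.exists_cons_of_ne_nil hL0
        simp only [List.cons_append, List.nil_append, List.cons.injEq] at this
        exact absurd this.1 (hL c (by simp)).ne'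
      · have hbL := ihL hL0 hndL fun L' hL' => by
          have := h (L' ++ m :: R) (by
            rw [stackSort_append_max L' R m
              (fun x hx => hL x ((mem_of_stackSort_eq hL').mp hx)) hR, hL'])
          exact List.append_cancel_right this
        have hbR := ihR hR0 (List.nodup_cons.mp hndR).2 fun R' hRR => by
          have := h (L ++ m :: R') (by
            rw [stackSort_append_max L R' m hL
              (fun x hx => hR x ((mem_of_stackSort_eq hRR).mp hx)), hRR])
          exact (List.cons.inj (List.append_cancel_left this)).2
        obtain ⟨A, a, hA, hmax⟩ := stackSort_eq_append_max hL0
        obtain ⟨b, B, hB⟩ := List.exists_cons_of_ne_nil (mt stackSort_eq_nil.mp hR0)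
        have haL : a ∈ L := mem_stackSort.mp (by simp [hA])
        have hbR' : b ∈ R := mem_stackSort.mp (by simp [hB])
        have hab : b < a := by
          -- If the junction is not a descent, then all of `L` lies below the first letter of
          -- `s(R)`, and `L` can be absorbed into the right part, giving a preimage `m R'` that
          -- starts with `m`.
          by_contra hab
          have hne : a ≠ b := hdisj a haL b (by simp [hbR'])
          obtain ⟨R', hR''⟩ := exists_stackSort_eq_append hR0 L (by
            intro u hu x hx
            have : b = u := by simpa [hB] using hu
            have := hmax x hx
            omega)
          have := h ([] ++ m :: R') (by
            rw [stackSort_append_max [] R' m (by simp), hR'']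
            · simp [stackSort_nil]
            · intro x hx
              rw [← mem_stackSort, hR'', List.mem_append, mem_stackSort, mem_stackSort] at hx
              exact hx.elim (fun hx => (hL x hx).le) (hR x))
          obtain ⟨c, C, rfl⟩ := List.exists_cons_of_ne_nil hL0
          simp only [List.cons_append, List.nil_append, List.cons.injEq] at this
          exact (hL c (by simp)).ne' this.1
        have hm : ∀ x ∈ stackSort L ++ stackSort R, x ≤ m := by
          intro x hx
          rw [List.mem_append, mem_stackSort, mem_stackSort] at hx
          exact hx.elim (fun hx => (hL x hx).le) (hR x)
        rw [hA, hB] at hm ⊢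
        exact (hA ▸ hbL).append_max (hB ▸ hbR) hab hm

/-- This is the equality case of `descentCount_stackSort_le`: no slack can be lost in either part or
at the junction. -/
theorem stackSort_split_of_tight {L R : List ℕ}
    (h : (stackSort L).length + (stackSort R).length =
      2 * descentCount (stackSort L ++ stackSort R)) :
    (L = [] ∧ R = []) ∨ (L ≠ [] ∧ R ≠ [] ∧
      (stackSort L).length = 2 * descentCount (stackSort L) + 1 ∧
      (stackSort R).length = 2 * descentCount (stackSort R) + 1 ∧
      ∃ A a b B, stackSort L = A ++ [a] ∧ stackSort R = b :: B ∧ b < a) := by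
  rcases eq_or_ne L [] with rfl | hL0
  · rcases eq_or_ne R [] with rfl | hR0
    · exact .inl ⟨rfl, rfl⟩
    · have := descentCount_stackSort_le hR0
      simp [stackSort_nil] at h; omega
  · rcases eq_or_ne R [] with rfl | hR0
    · have := descentCount_stackSort_le hL0
      simp [stackSort_nil] at h; omega
    · have h1 := descentCount_stackSort_le hR0
      have h2 := descentCount_stackSort_le hL0
      obtain ⟨A, a, hA, -⟩ := stackSort_eq_append_max hL0
      obtain ⟨b, B, hB⟩ := List.exists_cons_of_ne_nil (mt stackSort_eq_nil.mp hR0)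
      rw [hA, hB] at h ⊢
      rw [hA] at h2
      rw [hB] at h1
      rw [descentCount_append] at h
      refine .inr ⟨hL0, hR0, ?_, ?_, A, a, b, B, rfl, rfl, ?_⟩
      · split_ifs at h <;> omega
      · split_ifs at h <;> omega
      · by_contra hab
        rw [if_neg hab] at h; omega

theorem isBallot_of_tight {v : List ℕ} (hv : v ≠ [])
    (h : (stackSort v).length = 2 * descentCount (stackSort v) + 1) :
    IsBallot (stackSort v) := by
  induction v using max_induction with
  | nil => exact absurd rfl hv
  | node L m R hL hR ihL ihR =>
    rw [descentCount_stackSort_append_max L R m hL hR] at h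
    rw [stackSort_append_max L R m hL hR] at h ⊢
    simp only [List.length_append, List.length_singleton, add_left_inj] at h
    rcases stackSort_split_of_tight h with ⟨rfl, rfl⟩ |
      ⟨hL0, hR0, h1, h2, A, a, b, B, hA, hB, hab⟩
    · simpa [stackSort_nil] using isBallot_singleton m
    · have hm : ∀ x ∈ stackSort L ++ stackSort R, x ≤ m := by
        intro x hx
        rw [List.mem_append, mem_stackSort, mem_stackSort] at hx
        exact hx.elim (fun hx => (hL x hx).le) (hR x)
      have hbL := ihL hL0 h1
      have hbR := ihR hR0 h2
      rw [hA] at hbL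
      rw [hB] at hbR
      rw [hA, hB] at hm ⊢
      exact hbL.append_max hbR hab hm

/-- Were `C` nonempty, the marks of the second word would contribute their full sum `1` after the
descent, leaving sum `0` for the prefix `C`, which is not positive. This makes the cut in a tight
word unique. -/
theorem eq_nil_of_ballot_append {C B : List ℕ} {b : ℕ} (hCB : IsBallot (C ++ b :: B))
    (hB : IsBallot (b :: B)) (h : ∀ c ∈ C.getLast?, b < c) : C = [] := by
  rcases List.eq_nil_or_concat C with rfl | ⟨C, c, rfl⟩
  · rfl
  · rw [List.concat_eq_append] at *
    have h1 := hCB.1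
    have h2 := hCB.2 (C ++ [c]) (by simp) (List.prefix_append _ _)
    rw [descentCount_append_of_lt _ _ (h c (by simp)), List.length_append, hB.1] at h1
    omega

/-- Two preimages cut the same word at descents into ballot parts. If the cuts differed, one right
part would be a proper suffix of the other, against `eq_nil_of_ballot_append`. -/
theorem stackSort_injective_of_tight {v v' : List ℕ} (hv : stackSort v' = stackSort v)
    (h : (stackSort v).length = 2 * descentCount (stackSort v) + 1) : v' = v := by
  induction v using max_induction generalizing v' with
  | nil => simp [stackSort_nil] at h
  | node L m R hL hR ihL ihR =>
    have hv0 : v' ≠ [] := by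
      rintro rfl
      rw [stackSort_nil, eq_comm, stackSort_eq_nil] at hv
      simp at hv
    obtain ⟨L', m', R', rfl, hL', hR'⟩ := exists_max_split hv0
    have h' := h
    rw [← hv] at h'
    rw [descentCount_stackSort_append_max L R m hL hR, stackSort_append_max L R m hL hR] at h
    rw [descentCount_stackSort_append_max L' R' m' hL' hR',
      stackSort_append_max L' R' m' hL' hR'] at h'
    rw [stackSort_append_max L R m hL hR, stackSort_append_max L' R' m' hL' hR'] at hv
    obtain ⟨hs, hm⟩ := List.append_inj' hv rfl
    obtain rfl : m' = m := by simpa using hm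
    simp only [List.length_append, List.length_singleton, add_left_inj] at h h'
    rcases stackSort_split_of_tight h with ⟨rfl, rfl⟩ |
      ⟨hL0, hR0, h1, h2, A, a, b, B, hA, hB, hab⟩
    · simp only [stackSort_nil, List.append_nil, List.append_eq_nil_iff, stackSort_eq_nil] at hs
      rw [hs.1, hs.2]
    · rcases stackSort_split_of_tight h' with ⟨rfl, rfl⟩ |
        ⟨hL0', hR0', h1', h2', A', a', b', B', hA', hB', hab'⟩
      · simp [stackSort_nil, hA] at hs
      · have hbR := isBallot_of_tight hR0 h2
        have hbR' := isBallot_of_tight hR0' h2'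
        have heq : stackSort L' = stackSort L := by
          rcases List.append_eq_append_iff.mp hs with ⟨C, hC, hC'⟩ | ⟨C, hC, hC'⟩
          · rw [hC', hB] at hbR'
            rw [hB] at hbR
            rw [eq_nil_of_ballot_append hbR' hbR ?_, List.append_nil] at hC
            · exact hC.symm
            · intro c hc
              have : a = c := by
                have e := congrArg List.getLast? hC
                simpa [hA, List.getLast?_append, Option.mem_def.mp hc] using e
              omega
          · rw [hC', hB'] at hbR
            rw [hB'] at hbR'
            rw [eq_nil_of_ballot_append hbR hbR' ?_, List.append_nil] at hC
            · exact hC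
            · intro c hc
              have : a' = c := by
                have e := congrArg List.getLast? hC
                simpa [hA', List.getLast?_append, Option.mem_def.mp hc] using e
              omega
        rw [ihL heq h1]
        rw [heq] at hs
        rw [ihR (List.append_cancel_left hs) h2]

/-! ### Words avoiding 312 -/

/-- The word `w` avoids the pattern `312`. -/
def Avoids312 (w : List ℕ) : Prop :=
  ∀ a b c, [a, b, c].Sublist w → ¬ (b < c ∧ c < a)

theorem Avoids312.sublist {w v : List ℕ} (h : Avoids312 w) (hv : v.Sublist w) : Avoids312 v :=
  fun a b c habc => h a b c (habc.trans hv)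

/-- A ballot word of length greater than one is `A B m`, where `A` and `B` are ballot words with a
descent in between, and `m` follows an ascent. -/
theorem IsBallot.exists_split {w : List ℕ} (h : IsBallot w) (hw : w.length ≠ 1) :
    ∃ A a b B m, w = A ++ [a] ++ b :: B ++ [m] ∧ b < a ∧ IsBallot (A ++ [a]) ∧
      IsBallot (b :: B) ∧ ∃ C c, b :: B = C ++ [c] ∧ c ≤ m := by
  obtain ⟨hlen, hpre⟩ := h
  rcases List.eq_nil_or_concat w with rfl | ⟨u, m, rfl⟩
  · simp at hlen
  rw [List.concat_eq_append] at *
  simp only [List.length_append, List.length_singleton] at hlen hw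
  have hu0 : u ≠ [] := by rintro rfl; simp at hw
  have hpreu : ∀ P, P ≠ [] → P <+: u → P.length ≤ 2 * descentCount P + 1 :=
    fun P hP h => hpre P hP (h.trans (List.prefix_append _ _))
  have hu := hpreu u hu0 (List.prefix_refl _)
  -- `Q i` says that the marks of the first `i` letters sum to `1`. The cut is made at the last such
  -- `i`: the next letter must follow a descent, and all later partial sums are at least `2`. The
  -- marks of `u` sum to `2`, so `i` is not its full length.
  let Q : ℕ → Prop := fun i => 0 < i ∧ i = 2 * descentCount (u.take i) + 1
  classical
  have hupos : 0 < u.length := List.length_pos_iff.mpr hu0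
  have hQ1 : Q 1 := by
    refine ⟨one_pos, ?_⟩
    obtain ⟨c, C, rfl⟩ := List.exists_cons_of_ne_nil hu0
    simp [descentCount]
  obtain ⟨i, hi⟩ : ∃ i, i = Nat.findGreatest Q u.length := ⟨_, rfl⟩
  have hQi : Q i := hi ▸ Nat.findGreatest_spec (P := Q) hupos hQ1
  have hmax : ∀ j, i < j → j ≤ u.length → ¬ Q j := fun j hj hj' =>
    Nat.findGreatest_is_greatest (hi ▸ hj) hj'
  have hiu : i ≤ u.length := hi ▸ Nat.findGreatest_le _
  obtain ⟨hi0, hQi⟩ := hQi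
  have hiu' : i ≠ u.length := by
    rintro e
    rw [e, List.take_length] at hQi
    omega
  have hsplit := List.take_append_drop i u
  have hleni : (u.take i).length = i := List.length_take_of_le hiu
  rcases List.eq_nil_or_concat (u.take i) with h0 | ⟨A, a, hA⟩
  · rw [h0] at hleni; simp at hleni; omega
  rw [List.concat_eq_append] at hA
  cases hB : u.drop i with
  | nil => have := List.drop_eq_nil_iff.mp hB; omega
  | cons b B =>
    rw [hA, hB] at hsplit
    rw [hA] at hQi hleni
    rcases List.eq_nil_or_concat (b :: B) with h0 | ⟨C, c, hC⟩
    · simp at h0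
    rw [List.concat_eq_append] at hC
    have hdes : descentCount (u ++ [m]) = descentCount u + if m < c then 1 else 0 := by
      rw [← hsplit, hC, ← List.append_assoc, descentCount_append]
      simp [descentCount]
    have hcm : c ≤ m ∧ descentCount (u ++ [m]) = descentCount u := by
      split_ifs at hdes <;> omega
    have hab : b < a := by
      by_contra hab
      have h1 := hpreu (A ++ [a] ++ b :: []) (by simp) (by
        rw [← hsplit]
        exact (List.prefix_append_right_inj _).mpr (by simp))
      rw [descentCount_append, if_neg hab, List.length_append, hleni] at h1
      simp [descentCount] at h1
      omega
    refine ⟨A, a, b, B, m, by rw [hsplit], hab, ⟨by rw [hleni]; exact hQi, fun P hP h =>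
      hpreu P hP (h.trans ⟨_, hsplit⟩)⟩, ⟨?_, fun P hP h => ?_⟩, C, c, hC, hcm.1⟩
    · have h1 := congrArg List.length hsplit
      have h2 := descentCount_append_of_lt A B hab
      rw [hsplit] at h2
      rw [List.length_append, hleni] at h1
      omega
    · cases P with
      | nil => exact absurd rfl hP
      | cons b' P =>
        obtain ⟨rfl, -⟩ := List.cons_prefix_cons.mp h
        have hPu : A ++ [a] ++ b' :: P <+: u := by
          rw [← hsplit]
          exact (List.prefix_append_right_inj _).mpr h
        have h1 := hpreu _ (by simp) hPu
        have h2 := hmax (A ++ [a] ++ b' :: P).length (by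
          rw [List.length_append, hleni]; simp) hPu.length_le
        simp only [Q] at h2
        rw [← List.prefix_iff_eq_take.mp hPu] at h2
        rw [descentCount_append_of_lt _ _ hab, List.length_append, hleni] at h1 h2
        omega

/-- Avoidance of 312 makes the last letter `m` of the ballot splitting the largest: an earlier
letter `x > m`, together with the letter `c` just before `m`, would give the pattern `x c m`.
Preimages of the two parts are then joined around `m`. -/
theorem exists_stackSort_eq {w : List ℕ} (h : IsBallot w) (hnd : w.Nodup) (ha : Avoids312 w) :
    ∃ v, stackSort v = w := by
  induction hn : w.length using Nat.strong_induction_on generalizing w with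
  | _ n ih =>
    by_cases hw : w.length = 1
    · obtain ⟨m, rfl⟩ := List.length_eq_one_iff.mp hw
      exact ⟨[] ++ m :: [], by
        rw [stackSort_append_max _ _ _ (by simp) (by simp)]; simp [stackSort_nil]⟩
    · obtain ⟨A, a, b, B, m, rfl, hab, hA, hB, C, c, hC, hcm⟩ := h.exists_split hw
      have hlt : ∀ x ∈ A ++ [a] ++ b :: B, x < m := by
        intro x hx
        have hxm : x ≠ m := fun e =>
          (List.nodup_append.mp hnd).2.2 x hx m (by simp) e
        by_contra hlt
        rw [hC] at hx ha hnd
        have hcm' : c ≠ m :=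
          (List.nodup_append.mp hnd).2.2 c (by simp) m (by simp)
        have hx' : x ∈ A ++ [a] ++ C := by
          rw [← List.append_assoc] at hx
          rcases List.mem_append.mp hx with hx | hx
          · exact hx
          · simp at hx; omega
        refine ha x c m ?_ ⟨by omega, by omega⟩
        have h1 := (List.singleton_sublist.mpr hx').append (List.Sublist.refl [c, m])
        simpa using h1
      simp only [List.length_append, List.length_singleton] at hn
      have hndAB := (List.nodup_append.mp hnd).1
      obtain ⟨v, hv⟩ := ih _ (by simp only [List.length_append, List.length_singleton]; omega) hA
        (List.nodup_append.mp hndAB).1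
        (ha.sublist ((List.sublist_append_left _ _).trans (List.sublist_append_left _ _))) rfl
      obtain ⟨u, hu⟩ := ih _ (by omega) hB
        (List.nodup_append.mp hndAB).2.1
        (ha.sublist ((List.sublist_append_right _ _).trans (List.sublist_append_left _ _))) rfl
      refine ⟨v ++ m :: u, ?_⟩
      rw [stackSort_append_max, hv, hu]
      · intro x hx
        rw [← mem_stackSort, hv] at hx
        exact hlt x (List.mem_append_left _ hx)
      · intro x hx
        rw [← mem_stackSort, hu] at hx
        exact (hlt x (List.mem_append_right _ hx)).le

/-- A word avoiding `312` is uniquely sorted if and only if it is a ballot word. -/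
theorem fertility_eq_one_iff_isBallot {w : List ℕ} (h0 : w ≠ []) (hnd : w.Nodup)
    (hpos : ∀ x ∈ w, 0 < x) (ha : Avoids312 w) : fertility w = 1 ↔ IsBallot w := by
  rw [fertility_eq_one_iff hnd hpos]
  constructor
  · rintro ⟨v, rfl, h⟩
    exact isBallot_of_unique (mt stackSort_eq_nil.mpr h0) ((stackSort_perm v).nodup_iff.mp hnd) h
  · intro h
    obtain ⟨v, rfl⟩ := exists_stackSort_eq h hnd ha
    exact ⟨v, rfl, fun v' hv' => stackSort_injective_of_tight hv' h.1⟩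

open Finset

variable {m k : ℕ}

/-! ### Permutations avoiding 312 -/

/-- Avoidance of the pattern `312` in terms of positions. -/
def PermAvoids312 {n : ℕ} (π : Equiv.Perm (Fin n)) : Prop :=
  ∀ i j l, i < j → j < l → π j < π l → π i < π l

theorem not_containsPattern_iff {n : ℕ} (π : Equiv.Perm (Fin n)) :
    ¬ ContainsPattern π ![3, 1, 2] ↔ PermAvoids312 π := by
  constructor
  · intro h i j l hij hjl hv
    by_contra hil
    have hil' : π l < π i := lt_of_le_of_ne (not_lt.mp hil) fun e =>
      (hij.trans hjl).ne' (π.injective e)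
    refine h ⟨![i, j, l], ?_, ?_⟩
    · intro a b hab
      fin_cases a <;> fin_cases b <;> simp at hab ⊢ <;> first | assumption | exact hij.trans hjl
    · intro a b
      have := hv.trans hil'
      fin_cases a <;> fin_cases b <;> simp <;> first | assumption | exact le_of_lt (by assumption)
  · rintro h ⟨f, hf, hval⟩
    have h1 := h (f 0) (f 1) (f 2) (hf (by decide)) (hf (by decide)) ((hval 1 2).mpr (by simp))
    exact absurd ((hval 0 2).mp h1) (by simp)

/-- The positions of the ascents of a permutation. -/
def ascents (π : Equiv.Perm (Fin (m + 1))) : Finset (Fin m) :=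
  {p | π p.castSucc < π p.succ}

/-- The letters `v` that precede the letter `v + 1` in a permutation. -/
def inverseAscents (π : Equiv.Perm (Fin (m + 1))) : Finset (Fin m) :=
  {v | π.symm v.castSucc < π.symm v.succ}

/-- The largest of the entries of a permutation up to a given position. -/
noncomputable def runningMax (π : Equiv.Perm (Fin (m + 1))) (i : Fin (m + 1)) : Fin (m + 1) :=
  (Finset.Iic i).sup π

theorem le_runningMax (π : Equiv.Perm (Fin (m + 1))) {i j : Fin (m + 1)} (h : j ≤ i) :
    π j ≤ runningMax π i :=
  Finset.le_sup (f := π) (Finset.mem_Iic.mpr h)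

theorem runningMax_le_iff (π : Equiv.Perm (Fin (m + 1))) {i v : Fin (m + 1)} :
    runningMax π i ≤ v ↔ ∀ j ≤ i, π j ≤ v := by
  simp [runningMax]

theorem exists_eq_runningMax (π : Equiv.Perm (Fin (m + 1))) (i : Fin (m + 1)) :
    ∃ j ≤ i, π j = runningMax π i := by
  obtain ⟨j, hj, h⟩ := Finset.exists_mem_eq_sup (Finset.Iic i) ⟨i, by simp⟩ π
  exact ⟨j, Finset.mem_Iic.mp hj, h.symm⟩

theorem runningMax_mono (π : Equiv.Perm (Fin (m + 1))) : Monotone (runningMax π) :=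
  fun _ _ h => Finset.sup_mono (Finset.Iic_subset_Iic.mpr h)

theorem le_runningMax_self (π : Equiv.Perm (Fin (m + 1))) (i : Fin (m + 1)) :
    i ≤ runningMax π i := by
  have h : (Finset.Iic i).map π.toEmbedding ⊆ Finset.Iic (runningMax π i) := by
    intro v hv
    obtain ⟨j, hj, rfl⟩ := Finset.mem_map.mp hv
    exact Finset.mem_Iic.mpr (le_runningMax π (Finset.mem_Iic.mp hj))
  have := Finset.card_le_card h
  rw [Finset.card_map, Fin.card_Iic, Fin.card_Iic] at this
  exact Fin.le_def.mpr (by omega)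

theorem runningMax_last (π : Equiv.Perm (Fin (m + 1))) :
    runningMax π (Fin.last m) = Fin.last m :=
  le_antisymm (Fin.le_last _) (le_runningMax_self π _)

/-- An entry reached by an ascent exceeds everything before it, since a larger earlier entry
followed by the ascent would be a 312. -/
theorem runningMax_lt_iff {π : Equiv.Perm (Fin (m + 1))} (h : PermAvoids312 π) (p : Fin m) :
    runningMax π p.castSucc < runningMax π p.succ ↔ p ∈ ascents π := by
  have hp : p.castSucc < p.succ := Fin.castSucc_lt_succ
  simp only [ascents, Finset.mem_filter, Finset.mem_univ, true_and]
  constructor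
  · intro hlt
    by_contra hle
    refine absurd ((runningMax_le_iff π).mpr fun j hj => ?_) (not_le.mpr hlt)
    rcases hj.lt_or_eq with hj | rfl
    · exact le_runningMax π (Fin.le_castSucc_iff.mpr hj)
    · exact (not_lt.mp hle).trans (le_runningMax π le_rfl)
  · intro hlt
    refine lt_of_lt_of_le ?_ (le_runningMax π le_rfl)
    obtain ⟨j, hj, hjm⟩ := exists_eq_runningMax π p.castSucc
    rw [← hjm]
    rcases hj.lt_or_eq with hj | rfl
    · exact h j _ _ hj hp hlt
    · exact hlt

/-- If `v` precedes `v + 1`, a larger entry before `v` would form a 312 with these two, so `v` is a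
record. Conversely, while the maximum is `v`, the letter `v + 1` has not yet appeared. -/
theorem mem_inverseAscents_iff {π : Equiv.Perm (Fin (m + 1))} (h : PermAvoids312 π)
    (v : Fin m) : v ∈ inverseAscents π ↔ ∃ i, runningMax π i = v.castSucc := by
  have hv : v.castSucc < v.succ := Fin.castSucc_lt_succ
  simp only [inverseAscents, Finset.mem_filter, Finset.mem_univ, true_and]
  constructor
  · intro hlt
    refine ⟨π.symm v.castSucc, le_antisymm ((runningMax_le_iff π).mpr fun j hj => ?_) ?_⟩
    · by_contra hjv
      rw [not_le] at hjv
      have hj' : j < π.symm v.castSucc := lt_of_le_of_ne hj fun e => by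
        rw [e, Equiv.apply_symm_apply] at hjv; exact lt_irrefl _ hjv
      have h1 := h j _ _ hj' hlt (by simp)
      rw [Equiv.apply_symm_apply] at h1
      rw [Fin.lt_def] at h1 hjv
      simp at h1 hjv
      omega
    · simpa using le_runningMax π (le_refl (π.symm v.castSucc))
  · rintro ⟨i, hi⟩
    obtain ⟨j, hj, hjm⟩ := exists_eq_runningMax π i
    rw [hi] at hjm
    rw [← hjm, Equiv.symm_apply_apply]
    by_contra hle
    have := le_runningMax π ((not_lt.mp hle).trans hj)
    rw [Equiv.apply_symm_apply, hi] at this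
    exact absurd this (not_le.mpr hv)

/-- The running maximum at an ascent, a bijection from the ascents to the inverse ascents of a
permutation avoiding `312`. -/
theorem exists_ascent_bijection {π : Equiv.Perm (Fin (m + 1))} (h : PermAvoids312 π) :
    ∃ f : Fin m → Fin m, (∀ p ∈ ascents π, (f p).castSucc = runningMax π p.castSucc) ∧
      Set.BijOn f (ascents π) (inverseAscents π) := by
  have hlt : ∀ p ∈ ascents π, runningMax π p.castSucc < Fin.last m := fun p hp =>
    ((runningMax_lt_iff h p).mpr hp).trans_le (Fin.le_last _)
  have hex : ∀ p, ∃ v : Fin m, p ∈ ascents π → v.castSucc = runningMax π p.castSucc := by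
    intro p
    by_cases hp : p ∈ ascents π
    · exact ⟨(runningMax π p.castSucc).castPred (hlt p hp).ne, fun _ => by simp⟩
    · exact ⟨p, fun h => absurd h hp⟩
  choose f hf using hex
  have hmono : ∀ p ∈ ascents π, ∀ q ∈ ascents π, p < q → f p < f q := by
    intro p hp q hq hpq
    rw [← Fin.castSucc_lt_castSucc_iff, hf p hp, hf q hq]
    refine ((runningMax_lt_iff h p).mpr hp).trans_le (runningMax_mono π ?_)
    rw [Fin.le_def]; rw [Fin.lt_def] at hpq; simp; omega
  refine ⟨f, hf, fun p hp => ?_, fun p hp q hq hpq => ?_, fun v hv => ?_⟩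
  · exact (mem_inverseAscents_iff h _).mpr ⟨_, (hf p hp).symm⟩
  · rcases lt_trichotomy p q with hlt | heq | hlt
    · exact absurd hpq (hmono p hp q hq hlt).ne
    · exact heq
    · exact absurd hpq (hmono q hq p hp hlt).ne'
  · obtain ⟨i, hi⟩ := (mem_inverseAscents_iff h v).mp hv
    -- The preimage of `v` is the last position at which the running maximum equals `v`.
    let s : Finset (Fin (m + 1)) := {j | runningMax π j = v.castSucc}
    obtain ⟨j, hj, hmax⟩ := s.exists_max_image id ⟨i, by simp [s, hi]⟩
    have hj' : runningMax π j = v.castSucc := by simpa [s] using hj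
    have hjl : j ≠ Fin.last m := by
      rintro rfl
      rw [runningMax_last] at hj'
      exact (Fin.castSucc_lt_last v).ne' hj'
    obtain ⟨p, rfl⟩ := Fin.exists_castSucc_eq.mpr hjl
    have hp : p ∈ ascents π := by
      rw [← runningMax_lt_iff h]
      refine lt_of_le_of_ne (runningMax_mono π Fin.castSucc_lt_succ.le) fun e => ?_
      have := hmax p.succ (by simp [s, ← e, hj'])
      exact absurd Fin.castSucc_lt_succ (not_lt.mpr this)
    refine ⟨p, hp, Fin.castSucc_injective m ?_⟩
    rw [hf p hp, hj']

/-- The number of elements of `S` that are at least `t`. -/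
def countGE (S : Finset (Fin m)) (t : ℕ) : ℕ := #(S.filter fun p : Fin m => t ≤ (p : ℕ))

theorem countGE_anti (S : Finset (Fin m)) {t u : ℕ} (h : t ≤ u) : countGE S u ≤ countGE S t :=
  Finset.card_le_card fun p hp => by
    simp only [Finset.mem_filter] at hp ⊢
    exact ⟨hp.1, h.trans hp.2⟩

theorem countGE_zero (S : Finset (Fin m)) : countGE S 0 = #S := by simp [countGE]

theorem countGE_eq_zero (S : Finset (Fin m)) {t : ℕ} (h : m ≤ t) : countGE S t = 0 := by
  rw [countGE, Finset.card_eq_zero, Finset.filter_eq_empty_iff]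
  intro p _
  have := p.isLt
  omega

theorem countGE_eq_succ (S : Finset (Fin m)) (p : Fin m) :
    countGE S p = countGE S (p + 1) + if p ∈ S then 1 else 0 := by
  have h : (S.filter fun q : Fin m => (p : ℕ) ≤ q) =
      (S.filter fun q : Fin m => (p : ℕ) + 1 ≤ q) ∪ if p ∈ S then {p} else ∅ := by
    ext q
    have : q = p ↔ (q : ℕ) = p := Fin.ext_iff
    split_ifs with hp
    · simp only [Finset.mem_filter, Finset.mem_union, Finset.mem_singleton]
      constructor
      · rintro ⟨hq, hle⟩
        rcases hle.lt_or_eq with hlt | heq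
        · exact .inl ⟨hq, hlt⟩
        · exact .inr (this.mpr heq.symm)
      · rintro (⟨hq, hle⟩ | rfl)
        · exact ⟨hq, by omega⟩
        · exact ⟨hp, le_rfl⟩
    · simp only [Finset.mem_filter, Finset.union_empty]
      refine and_congr_right fun hq => ?_
      have : (q : ℕ) ≠ p := fun e => hp (this.mpr e ▸ hq)
      omega
  rw [countGE, h, Finset.card_union_of_disjoint, countGE]
  · split_ifs <;> simp
  · split_ifs
    · simp
    · simp

/-- The bijection satisfies `p ≤ f p`, because the running maximum at a position is at least that
position. -/
theorem countGE_ascents_le {π : Equiv.Perm (Fin (m + 1))} (h : PermAvoids312 π) (t : ℕ) :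
    countGE (ascents π) t ≤ countGE (inverseAscents π) t := by
  obtain ⟨f, hf, hbij⟩ := exists_ascent_bijection h
  refine Finset.card_le_card_of_injOn f (fun p hp => ?_) (hbij.injOn.mono fun p hp => ?_)
  · simp only [Finset.coe_filter, Set.mem_ofPred_eq] at hp ⊢
    refine ⟨hbij.mapsTo hp.1, hp.2.trans ?_⟩
    have h1 := le_runningMax_self π p.castSucc
    rw [← hf p hp.1, Fin.le_def] at h1
    simpa using h1
  · simp only [Finset.coe_filter, Set.mem_ofPred_eq] at hp
    exact hp.1

theorem card_ascents_eq {π : Equiv.Perm (Fin (m + 1))} (h : PermAvoids312 π) :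
    #(ascents π) = #(inverseAscents π) := by
  obtain ⟨f, -, hbij⟩ := exists_ascent_bijection h
  exact Finset.card_nbij f hbij.mapsTo hbij.injOn hbij.surjOn

/-- For an ascent `p`, the value `f p` reaches the running maximum at `i` exactly when `i ≤ p`: an
ascent before `i` has already been followed by a jump. This equation recovers the running maximum
from the two sets. -/
theorem countGE_runningMax {π : Equiv.Perm (Fin (m + 1))} (h : PermAvoids312 π)
    (i : Fin (m + 1)) :
    countGE (inverseAscents π) (runningMax π i) = countGE (ascents π) i := by
  obtain ⟨f, hf, hbij⟩ := exists_ascent_bijection h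
  have key : ∀ p ∈ ascents π, (runningMax π i : ℕ) ≤ f p ↔ (i : ℕ) ≤ p := by
    intro p hp
    have h1 : ((f p : Fin m) : ℕ) = runningMax π p.castSucc := by
      rw [← hf p hp]; simp
    rw [h1, ← Fin.le_def]
    constructor
    · intro hle
      by_contra hlt
      have h2 := (runningMax_lt_iff h p).mpr hp
      have h3 := runningMax_mono π (a := p.succ) (b := i) (by
        rw [Fin.le_def]; simp; omega)
      exact absurd (h2.trans_le h3) (not_lt.mpr hle)
    · intro hle
      exact runningMax_mono π (by rw [Fin.le_def]; simpa using hle)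
  symm
  refine Finset.card_nbij f (fun p hp => ?_) (hbij.injOn.mono fun p hp => ?_) (fun v hv => ?_)
  · simp only [Finset.coe_filter, Set.mem_ofPred_eq] at hp ⊢
    exact ⟨hbij.mapsTo hp.1, (key p hp.1).mpr hp.2⟩
  · simp only [Finset.coe_filter, Set.mem_ofPred_eq] at hp
    exact hp.1
  · simp only [Finset.coe_filter, Set.mem_ofPred_eq] at hv
    obtain ⟨p, hp, rfl⟩ := hbij.surjOn hv.1
    exact ⟨p, by simpa using ⟨hp, (key p hp).mp hv.2⟩, rfl⟩

/-- If `v`, the running maximum of `π` at `i`, were the smaller one, it would be an inverse ascent.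
The count would drop strictly beyond `v`, but both running maxima have the same count. -/
theorem runningMax_le_of_eq {π σ : Equiv.Perm (Fin (m + 1))} (hπ : PermAvoids312 π)
    (hσ : PermAvoids312 σ) (hA : ascents π = ascents σ)
    (hV : inverseAscents π = inverseAscents σ) (i : Fin (m + 1)) :
    runningMax σ i ≤ runningMax π i := by
  by_contra hlt
  rw [not_le] at hlt
  have h1 := countGE_runningMax hπ i
  have h2 := countGE_runningMax hσ i
  rw [← hA, ← hV] at h2
  have hne : runningMax π i ≠ Fin.last m := (hlt.trans_le (Fin.le_last _)).ne
  obtain ⟨v, hv⟩ := Fin.exists_castSucc_eq.mpr hne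
  have hv' : v ∈ inverseAscents π := (mem_inverseAscents_iff hπ v).mpr ⟨i, hv.symm⟩
  have h3 := countGE_eq_succ (inverseAscents π) v
  rw [if_pos hv'] at h3
  have h4 := countGE_anti (inverseAscents π) (t := (v : ℕ) + 1) (u := runningMax σ i) (by
    rw [← hv, Fin.lt_def] at hlt; simpa using hlt)
  rw [← hv] at h1
  simp only [Fin.val_castSucc] at h1
  omega

/-- At the first disagreement, `σ i` is still unused in `π` and so occurs there after position `i`.
If `π i < σ i`, the earlier record, `π i` and `σ i` form a 312 in `π`. In effect each entry is the
largest unused value allowed by the running maximum. -/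
theorem not_lt_of_runningMax_eq {π σ : Equiv.Perm (Fin (m + 1))} (hπ : PermAvoids312 π)
    (h : ∀ i, runningMax π i = runningMax σ i) {i : Fin (m + 1)} (hi : ∀ j < i, π j = σ j) :
    ¬ π i < σ i := by
  intro hlt
  have hle : σ i ≤ runningMax π i := h i ▸ le_runningMax σ le_rfl
  obtain ⟨q, hq, hqm⟩ := exists_eq_runningMax π i
  rw [← hqm] at hle
  have hqi : q < i := lt_of_le_of_ne hq fun e => absurd hle (not_le.mpr (e ▸ hlt))
  have hil : i < π.symm (σ i) := by
    by_contra hil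
    rcases (not_lt.mp hil).lt_or_eq with h1 | h1
    · have := hi _ h1
      rw [Equiv.apply_symm_apply] at this
      exact h1.ne (σ.injective this).symm
    · rw [Equiv.symm_apply_eq] at h1
      exact hlt.ne h1.symm
  have := hπ q i _ hqi hil (by simpa using hlt)
  rw [Equiv.apply_symm_apply] at this
  exact absurd this (not_lt.mpr hle)

/-- A permutation avoiding `312` is determined by its ascents and inverse ascents. -/
theorem eq_of_ascents_eq {π σ : Equiv.Perm (Fin (m + 1))} (hπ : PermAvoids312 π)
    (hσ : PermAvoids312 σ) (hA : ascents π = ascents σ)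
    (hV : inverseAscents π = inverseAscents σ) : π = σ := by
  have h : ∀ i, runningMax π i = runningMax σ i := fun i =>
    le_antisymm (runningMax_le_of_eq hσ hπ hA.symm hV.symm i) (runningMax_le_of_eq hπ hσ hA hV i)
  ext1 i
  induction i using WellFoundedLT.induction with
  | _ i ih =>
    refine le_antisymm (not_lt.mp ?_) (not_lt.mp ?_)
    · exact not_lt_of_runningMax_eq hσ (fun i => (h i).symm) fun j hj => (ih j hj).symm
    · exact not_lt_of_runningMax_eq hπ h ih

/-- Every monotone function `M` with `i ≤ M i` is the running maximum of a permutation avoiding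
`312`. -/
theorem exists_perm_runningMax_eq {M : Fin (m + 1) → Fin (m + 1)} (hM : Monotone M)
    (hle : ∀ i, i ≤ M i) :
    ∃ π : Equiv.Perm (Fin (m + 1)), PermAvoids312 π ∧ ∀ i, runningMax π i = M i := by
  -- Greedy choice: `g i` is the largest value up to `M i` not used before. One is available since
  -- `i ≤ M i` leaves at least `i + 1` candidates and only `i` are used.
  have hex : ∃ g : Fin (m + 1) → Fin (m + 1), ∀ i,
      g i ≤ M i ∧ (∀ j < i, g i ≠ g j) ∧ ∀ v ≤ M i, (∀ j < i, v ≠ g j) → v ≤ g i := by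
    have step : ∀ (i : Fin (m + 1)) (g : (j : Fin (m + 1)) → j < i → Fin (m + 1)),
        ∃ u : Fin (m + 1), u ≤ M i ∧ (∀ j (hj : j < i), u ≠ g j hj) ∧
          ∀ v ≤ M i, (∀ j (hj : j < i), v ≠ g j hj) → v ≤ u := by
      intro i g
      classical
      let s : Finset (Fin (m + 1)) := {v | v ≤ M i ∧ ∀ j (hj : j < i), v ≠ g j hj}
      have hs : s.Nonempty := by
        by_contra hs
        rw [Finset.not_nonempty_iff_eq_empty, Finset.filter_eq_empty_iff] at hs
        have hsub : Finset.Iic (M i) ⊆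
            (Finset.Iio i).attach.image fun j => g j.1 (Finset.mem_Iio.mp j.2) := by
          intro v hv
          have := hs (Finset.mem_univ v)
          push Not at this
          obtain ⟨j, hj, e⟩ := this (Finset.mem_Iic.mp hv)
          exact Finset.mem_image.mpr ⟨⟨j, Finset.mem_Iio.mpr hj⟩, Finset.mem_attach _ _, e.symm⟩
        have h1 := (Finset.card_le_card hsub).trans Finset.card_image_le
        rw [Finset.card_attach, Fin.card_Iic, Fin.card_Iio] at h1
        have h2 := Fin.le_def.mp (hle i)
        omega
      obtain ⟨u, hu, hmax⟩ := s.exists_max_image id hs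
      simp only [s, Finset.mem_filter, Finset.mem_univ, true_and] at hu hmax
      exact ⟨u, hu.1, hu.2, fun v hv hv' => hmax v ⟨hv, hv'⟩⟩
    choose G hG using step
    refine ⟨WellFoundedLT.fix (motive := fun _ => Fin (m + 1)) G, fun i => ?_⟩
    rw [WellFoundedLT.fix_eq]
    exact hG i _
  obtain ⟨g, hg⟩ := hex
  have hinj : Function.Injective g := by
    intro i j hij
    rcases lt_trichotomy i j with h | h | h
    · exact absurd hij.symm ((hg j).2.1 i h)
    · exact h
    · exact absurd hij ((hg i).2.1 j h)
  let π : Equiv.Perm (Fin (m + 1)) := Equiv.ofBijective g (Finite.injective_iff_bijective.mp hinj)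
  have hπ : ∀ i, π i = g i := fun i => rfl
  refine ⟨π, fun a b c hab hbc hlt => ?_, fun i => le_antisymm ?_ ?_⟩
  · simp only [hπ] at hlt ⊢
    by_contra hle'
    -- In a 312, the value `g c` was unused and admissible at `b`, yet larger than the greedy choice
    -- `g b`.
    refine absurd ((hg b).2.2 (g c) ?_ fun j hj => (hg c).2.1 j (hj.trans hbc)) (not_le.mpr hlt)
    exact (not_lt.mp hle').trans ((hg a).1.trans (hM hab.le))
  · exact (runningMax_le_iff π).mpr fun j hj => (hg j).1.trans (hM hj)
  · by_cases hmem : ∃ j < i, M i = g j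
    · obtain ⟨j, hj, e⟩ := hmem
      rw [e]
      exact le_runningMax π hj.le
    · push Not at hmem
      exact ((hg i).2.2 (M i) le_rfl hmem).trans (le_runningMax π le_rfl)

/-- Any two sets `S` and `T` of the same size, with `T` dominating `S`, are the ascents and the
inverse ascents of a permutation avoiding `312`. -/
theorem exists_perm_ascents_eq {S T : Finset (Fin m)} (hcard : #S = #T)
    (hle : ∀ t, countGE S t ≤ countGE T t) :
    ∃ π : Equiv.Perm (Fin (m + 1)), PermAvoids312 π ∧ ascents π = S ∧ inverseAscents π = T := by
  -- By `countGE_runningMax`, the running maximum at `i` has to be the largest value whose count in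
  -- `T` is at least the count of `S` from `i` on.
  have hex : ∀ i : Fin (m + 1), ∃ j : Fin (m + 1), countGE S i ≤ countGE T j ∧
      ∀ v : Fin (m + 1), countGE S i ≤ countGE T v → v ≤ j := by
    intro i
    let s : Finset (Fin (m + 1)) := {v | countGE S i ≤ countGE T v}
    obtain ⟨j, hj, hmax⟩ := s.exists_max_image id ⟨i, by simp [s, hle]⟩
    simp only [s, Finset.mem_filter, Finset.mem_univ, true_and] at hj hmax
    exact ⟨j, hj, hmax⟩
  choose M hM hmax using hex
  have hmono : Monotone M := fun i j hij =>
    hmax j (M i) ((countGE_anti S (Fin.le_def.mp hij)).trans (hM i))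
  -- By maximality the count in `T` falls below the required one just after `v`. Passing one value
  -- lowers it by at most one, so `v` lies in `T` and the count at `v` is exact.
  have hval : ∀ i (v : Fin m), M i = v.castSucc →
      v ∈ T ∧ countGE T v = countGE S i := by
    intro i v hv
    have h1 := hM i
    have h2 := countGE_eq_succ T v
    have h3 : ¬ countGE S i ≤ countGE T v.succ := fun h3 => by
      have := hmax i _ h3
      rw [hv] at this
      exact absurd Fin.castSucc_lt_succ (not_lt.mpr this)
    rw [hv] at h1
    simp only [Fin.val_castSucc, Fin.val_succ] at h1 h3
    split_ifs at h2 with hT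
    · exact ⟨hT, by omega⟩
    · omega
  have hcount : ∀ i, countGE T (M i) = countGE S i := by
    intro i
    by_cases hl : M i = Fin.last m
    · have h1 := hM i
      rw [hl, Fin.val_last, countGE_eq_zero T le_rfl] at *
      omega
    · obtain ⟨v, hv⟩ := Fin.exists_castSucc_eq.mpr hl
      rw [← hv]
      exact (hval i v hv.symm).2
  obtain ⟨π, hπ, hrun⟩ := exists_perm_runningMax_eq hmono fun i => hmax i i (hle i)
  have hA : ascents π = S := by
    ext p
    rw [← runningMax_lt_iff hπ, hrun, hrun]
    have h1 := countGE_eq_succ S p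
    have h2 := hcount p.castSucc
    have h3 := hcount p.succ
    simp only [Fin.val_castSucc, Fin.val_succ] at h2 h3
    constructor
    · intro hlt
      by_contra hp
      rw [if_neg hp] at h1
      refine absurd (hmax p.castSucc (M p.succ) ?_) (not_le.mpr hlt)
      simp only [Fin.val_castSucc]
      omega
    · intro hp
      rw [if_pos hp] at h1
      refine lt_of_le_of_ne (hmono Fin.castSucc_lt_succ.le) fun e => ?_
      rw [e] at h2
      omega
  refine ⟨π, hπ, hA, Finset.eq_of_subset_of_card_le (fun v hv => ?_) ?_⟩
  · obtain ⟨i, hi⟩ := (mem_inverseAscents_iff hπ v).mp hv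
    rw [hrun] at hi
    exact (hval i v hi).1
  · rw [← card_ascents_eq hπ, hA, hcard]

/-! ### One-line notation -/

theorem length_oneLine {n : ℕ} (π : Equiv.Perm (Fin n)) : (oneLine π).length = n := by
  simp [oneLine]

theorem nodup_oneLine {n : ℕ} (π : Equiv.Perm (Fin n)) : (oneLine π).Nodup := by
  rw [oneLine, List.nodup_ofFn]
  intro i j h
  exact π.injective (Fin.ext (by simpa using h))

theorem pos_of_mem_oneLine {n : ℕ} (π : Equiv.Perm (Fin n)) : ∀ x ∈ oneLine π, 0 < x := by
  intro x hx
  obtain ⟨i, rfl⟩ := (List.mem_ofFn' _ _).mp hx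
  exact Nat.succ_pos _

theorem avoids312_oneLine {n : ℕ} {π : Equiv.Perm (Fin n)} (h : PermAvoids312 π) :
    Avoids312 (oneLine π) := by
  intro a b c habc hlt
  obtain ⟨f, hf⟩ := List.sublist_iff_exists_fin_orderEmbedding_get_eq.mp habc
  let g : Fin 3 → Fin n := fun i => Fin.cast (length_oneLine π) (f i)
  have hg : StrictMono g := fun i j hij => f.strictMono hij
  have hv : ∀ i : Fin 3, [a, b, c].get i = (π (g i) : ℕ) + 1 := by
    intro i
    rw [hf i]
    simp [oneLine, g]
    rfl
  have h0 : a = (π (g 0) : ℕ) + 1 := hv 0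
  have h1 : b = (π (g 1) : ℕ) + 1 := hv 1
  have h2 : c = (π (g 2) : ℕ) + 1 := hv 2
  have := h (g 0) (g 1) (g 2) (hg (by decide)) (hg (by decide)) (Fin.lt_def.mpr (by omega))
  rw [Fin.lt_def] at this
  omega

/-- Each of the first `i` adjacent pairs is an ascent or a descent; the ascents of the whole word
appear on the left to avoid subtraction. -/
theorem descentCount_take_oneLine (π : Equiv.Perm (Fin (m + 1))) (i : ℕ) (hi : i ≤ m) :
    descentCount ((oneLine π).take (i + 1)) + #(ascents π) = i + countGE (ascents π) i := by
  induction i with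
  | zero =>
    rw [countGE_zero]
    simp [oneLine, List.ofFn_succ, descentCount]
  | succ i ih =>
    have ih := ih (by omega)
    have hg : ∀ j (hj : j < m + 1), (oneLine π)[j]? = some ((π ⟨j, hj⟩ : ℕ) + 1) := by
      intro j hj
      rw [oneLine, List.getElem?_ofFn, dif_pos hj]
    have hcount := countGE_eq_succ (ascents π) ⟨i, hi⟩
    have h1 : (oneLine π).take (i + 1) = (oneLine π).take i ++ [(π ⟨i, by omega⟩ : ℕ) + 1] := by
      rw [List.take_add_one, hg i (by omega)]; rfl
    have h2 : (oneLine π).take (i + 1 + 1) =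
        (oneLine π).take i ++ [(π ⟨i, by omega⟩ : ℕ) + 1] ++
          ((π ⟨i + 1, by omega⟩ : ℕ) + 1) :: [] := by
      rw [List.take_add_one, hg (i + 1) (by omega), h1]; rfl
    rw [h2, descentCount_append, ← h1]
    have hasc : (⟨i, hi⟩ : Fin m) ∈ ascents π ↔
        (π ⟨i, by omega⟩ : ℕ) < π ⟨i + 1, by omega⟩ := by
      simp only [ascents, Finset.mem_filter, Finset.mem_univ, true_and]
      rfl
    have hne : (π ⟨i, by omega⟩ : ℕ) ≠ π ⟨i + 1, by omega⟩ := fun e => by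
      have := π.injective (Fin.ext e)
      simp at this
    simp only at hcount
    simp only [hasc] at hcount
    simp only [descentCount]
    split_ifs at hcount ⊢ <;> omega

/-- The set of positions, counted from the right, of the up steps of a Dyck path. -/
def IsDyckSet (S : Finset (Fin (2 * k))) : Prop :=
  #S = k ∧ ∀ i ≤ 2 * k, i ≤ 2 * countGE S (2 * k - i)

/-- With `k` ascents in all, the prefix inequality at length `j + 1` rearranges to `2k - j ≤ 2 *
countGE (ascents π) j`, which is the Dyck condition at `i = 2k - j`. -/
theorem isBallot_oneLine_iff (π : Equiv.Perm (Fin (2 * k + 1))) :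
    IsBallot (oneLine π) ↔ IsDyckSet (ascents π) := by
  have hlen := length_oneLine π
  have hfull := descentCount_take_oneLine π (2 * k) le_rfl
  rw [List.take_of_length_le hlen.le, countGE_eq_zero _ le_rfl] at hfull
  constructor
  · rintro ⟨h1, h2⟩
    refine ⟨by omega, fun i hi => ?_⟩
    have h3 := h2 ((oneLine π).take (2 * k - i + 1))
      (by rw [← List.length_pos_iff, List.length_take]; omega) (List.take_prefix _ _)
    have h4 := descentCount_take_oneLine π (2 * k - i) (by omega)
    rw [List.length_take] at h3
    omega
  · rintro ⟨h1, h2⟩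
    refine ⟨by omega, fun P hP h => ?_⟩
    have hPlen := h.length_le
    have hPpos := List.length_pos_iff.mpr hP
    have h3 := h2 (2 * k + 1 - P.length) (by omega)
    have h4 := descentCount_take_oneLine π (P.length - 1) (by omega)
    rw [Nat.sub_add_cancel hPpos, ← List.prefix_iff_eq_take.mp h] at h4
    rw [show 2 * k - (2 * k + 1 - P.length) = P.length - 1 by omega] at h3
    omega

/-- The uniquely sorted permutations avoiding `312`. -/
theorem mem_uniquelySorted312_iff (π : Equiv.Perm (Fin (2 * k + 1))) :
    π ∈ uniquelySorted312 (2 * k + 1) ↔ PermAvoids312 π ∧ IsDyckSet (ascents π) := by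
  rw [uniquelySorted312, Set.mem_ofPred_eq, not_containsPattern_iff, and_comm]
  refine and_congr_right fun h => ?_
  rw [← isBallot_oneLine_iff, IsUniquelySorted]
  refine fertility_eq_one_iff_isBallot ?_ (nodup_oneLine π) (pos_of_mem_oneLine π)
    (avoids312_oneLine h)
  rw [← List.length_pos_iff, length_oneLine]
  omega

/-! ### Words over `{U, D}` and sets -/

/-- The word whose up steps, counted from the right, are at the positions in `S`. -/
def wordOf (S : Finset (Fin m)) : List DyckStep :=
  List.ofFn fun i : Fin m => if i.rev ∈ S then DyckStep.U else DyckStep.D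

theorem length_wordOf (S : Finset (Fin m)) : (wordOf S).length = m := by simp [wordOf]

theorem lowerWord_eq (π : Equiv.Perm (Fin (2 * k + 1))) : lowerWord π = wordOf (ascents π) := by
  rw [lowerWord, wordOf]
  congr 1
  funext i
  have h : i.rev ∈ descents π ↔ ¬ i.rev ∈ ascents π := by
    simp only [descents, ascents, Finset.mem_filter, Finset.mem_univ, true_and, not_lt]
    exact ⟨le_of_lt, fun h => lt_of_le_of_ne h fun e =>
      Fin.castSucc_lt_succ.ne' (π.injective e)⟩
  simp only [h, ite_not]

/-- Reversal turns the ascents of the inverse permutation into the descents of `rot π` at mirrored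
positions. -/
theorem upperWord_eq (π : Equiv.Perm (Fin (2 * k + 1))) :
    upperWord π = wordOf (inverseAscents π) := by
  rw [upperWord, wordOf]
  congr 1
  funext i
  have h : i ∈ descents (rot π) ↔ i.rev ∈ inverseAscents π := by
    simp [descents, inverseAscents, rot, Fin.rev_succ, Fin.rev_castSucc]
  simp only [h]

theorem upCount_wordOf (S : Finset (Fin m)) (i : ℕ) :
    upCount (wordOf S) i = countGE S (m - i) := by
  induction i with
  | zero => simp [upCount, countGE_eq_zero S le_rfl]
  | succ i ih =>
    rcases lt_or_ge i m with hi | hi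
    · have h := countGE_eq_succ S (Fin.rev ⟨i, hi⟩)
      have hi' : (wordOf S)[i]? = some (if Fin.rev ⟨i, hi⟩ ∈ S then .U else .D) := by
        simp [wordOf, hi]
      rw [upCount, List.take_add_one, hi', List.count_append, ← upCount, ih]
      simp only [Fin.val_rev] at h
      rw [show m - (i + 1) + 1 = m - i by omega] at h
      rw [h]
      split_ifs <;> simp
    · rw [upCount, List.take_of_length_le (by rw [length_wordOf]; omega)]
      rw [upCount, List.take_of_length_le (by rw [length_wordOf]; omega)] at ih
      rw [ih, Nat.sub_eq_zero_of_le hi, Nat.sub_eq_zero_of_le (by omega)]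

theorem wordOf_injective : Function.Injective (wordOf (m := m)) := by
  intro S T h
  have h' := List.ofFn_injective h
  ext p
  have := congrFun h' p.rev
  simp only [Fin.rev_rev] at this
  split_ifs at this <;> simp_all

theorem exists_eq_wordOf {w : List DyckStep} (hw : w.length = m) : ∃ S, w = wordOf (m := m) S := by
  subst hw
  refine ⟨Finset.univ.filter fun p => w.get p.rev = DyckStep.U, ?_⟩
  conv_lhs => rw [← List.ofFn_get w]
  rw [wordOf]
  congr 1
  funext i
  simp only [Finset.mem_filter, Finset.mem_univ, true_and, Fin.rev_rev]
  cases w.get i <;> simp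

theorem upCount_wordOf_le_iff {S T : Finset (Fin m)} :
    (∀ i, upCount (wordOf S) i ≤ upCount (wordOf T) i) ↔ ∀ t, countGE S t ≤ countGE T t := by
  simp only [upCount_wordOf]
  refine ⟨fun h t => ?_, fun h i => h _⟩
  rcases le_total t m with ht | ht
  · have := h (m - t)
    rwa [Nat.sub_sub_self ht] at this
  · rw [countGE_eq_zero S ht]
    exact Nat.zero_le _

/-! ### Dyck paths as subsets of positions -/

theorem count_U_add_count_D (w : List DyckStep) :
    w.count DyckStep.U + w.count DyckStep.D = w.length := by
  induction w with
  | nil => rfl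
  | cons a w ih => cases a <;> simp <;> omega

theorem isDyckSet_of_dyckPath {S : Finset (Fin (2 * k))} {p : DyckPath k}
    (h : p.word = wordOf S) : IsDyckSet S := by
  have hlen := p.length_word
  have hU : p.word.count DyckStep.U = k := p.semilength_eq
  constructor
  · rw [← countGE_zero, ← Nat.sub_self (2 * k), ← upCount_wordOf, ← h, upCount,
      List.take_of_length_le hlen.le, hU]
  · intro i hi
    rw [← upCount_wordOf, ← h, upCount]
    have h1 := count_U_add_count_D (p.word.take i)
    have h2 : (p.word.take i).count DyckStep.D ≤ (p.word.take i).count DyckStep.U :=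
      p.path.count_D_le_count_U i
    rw [List.length_take, hlen] at h1
    omega

theorem exists_dyckPath {S : Finset (Fin (2 * k))} (h : IsDyckSet S) :
    ∃ p : DyckPath k, p.word = wordOf S := by
  have hU : (wordOf S).count DyckStep.U = k := by
    have h1 := upCount_wordOf S (2 * k)
    rwa [upCount, List.take_of_length_le (length_wordOf S).le, Nat.sub_self, countGE_zero,
      h.1] at h1
  have hUD := count_U_add_count_D (wordOf S)
  rw [length_wordOf] at hUD
  refine ⟨⟨⟨wordOf S, by omega, fun i => ?_⟩, hU⟩, rfl⟩
  rcases le_total i (2 * k) with hi | hi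
  · have h1 := count_U_add_count_D ((wordOf S).take i)
    have h2 := upCount_wordOf S i
    have h3 := h.2 i hi
    rw [List.length_take, length_wordOf] at h1
    rw [upCount] at h2
    omega
  · rw [List.take_of_length_le (by rwa [length_wordOf])]
    omega

theorem DyckPath.ext_word {p q : DyckPath k} (h : p.word = q.word) : p = q :=
  DyckPath.ext (DyckWord.ext h)

theorem exists_interval {π : Equiv.Perm (Fin (2 * k + 1))}
    (hπ : π ∈ uniquelySorted312 (2 * k + 1)) :
    ∃ I : NonemptyInterval (DyckPath k), intervalWords I = DL k π := by
  obtain ⟨ha, hd⟩ := (mem_uniquelySorted312_iff π).mp hπ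
  have hle := countGE_ascents_le ha
  -- The Dyck condition passes upward under domination.
  have hd' : IsDyckSet (inverseAscents π) :=
    ⟨by rw [← card_ascents_eq ha, hd.1], fun i hi =>
      (hd.2 i hi).trans (Nat.mul_le_mul_left 2 (hle _))⟩
  obtain ⟨p, hp⟩ := exists_dyckPath hd
  obtain ⟨q, hq⟩ := exists_dyckPath hd'
  have hpq : p ≤ q := fun i => by
    rw [hp, hq]
    exact upCount_wordOf_le_iff.mpr hle i
  exact ⟨⟨(p, q), hpq⟩, by rw [DL, lowerWord_eq, upperWord_eq, ← hp, ← hq]; rfl⟩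

end UniquelySorted

/-- For every `k ≥ 0`, the pair of words `DL_k(π)` of a uniquely sorted 312-avoiding permutation `π`
of length `2k + 1` is an interval of the Stanley lattice on Dyck paths of semilength `k`, and the
resulting map into the set of all these intervals is a bijection. -/
theorem theorem2 (k : ℕ) :
    ∃ F : UniquelySorted.uniquelySorted312 (2 * k + 1) →
        NonemptyInterval (UniquelySorted.DyckPath k),
      (∀ π, UniquelySorted.intervalWords (F π) = UniquelySorted.DL k π) ∧
        Function.Bijective F := by
  open UniquelySorted in
  choose F hF using fun π : uniquelySorted312 (2 * k + 1) => exists_interval π.2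
  refine ⟨F, hF, fun π σ h => ?_, fun I => ?_⟩
  · have hDL : DL k π.1 = DL k σ.1 := by rw [← hF, ← hF, h]
    simp only [DL, lowerWord_eq, upperWord_eq, Prod.mk.injEq] at hDL
    exact Subtype.ext (eq_of_ascents_eq ((mem_uniquelySorted312_iff _).mp π.2).1
      ((mem_uniquelySorted312_iff _).mp σ.2).1 (wordOf_injective hDL.1) (wordOf_injective hDL.2))
  · obtain ⟨S, hS⟩ := exists_eq_wordOf I.fst.length_word
    obtain ⟨T, hT⟩ := exists_eq_wordOf I.snd.length_word
    have hdS := isDyckSet_of_dyckPath hS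
    have hdT := isDyckSet_of_dyckPath hT
    have hle : ∀ i, upCount I.fst.word i ≤ upCount I.snd.word i := I.fst_le_snd
    rw [hS, hT, upCount_wordOf_le_iff] at hle
    obtain ⟨π, hπ, rfl, rfl⟩ := exists_perm_ascents_eq (hdS.1.trans hdT.1.symm) hle
    refine ⟨⟨π, (mem_uniquelySorted312_iff π).mpr ⟨hπ, hdS⟩⟩, ?_⟩
    have h := hF ⟨π, (mem_uniquelySorted312_iff π).mpr ⟨hπ, hdS⟩⟩
    rw [DL, lowerWord_eq, upperWord_eq, ← hS, ← hT, intervalWords, Prod.mk.injEq] at h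
    exact NonemptyInterval.ext (Prod.ext (DyckPath.ext_word h.1) (DyckPath.ext_word h.2))
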